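/- For a differentiable $f:\mathbb{R}^d\to\mathbb{R}$, the Hamiltonian flow $\varphi_t(x,v)=(x_t(x,v),v_t(x,v))$, $t\ge 0$, is the solution of $\frac{dx_t}{dt}=v_t$, $\frac{dv_t}{dt}=-\nabla f(x_t)$ started from $(x,v)$. Idealized HMC with integration time $T$ is the Markov chain $X_{i}=x_T(X_{i-1},\xi_i)$, where the momenta $\xi_i\sim N(0,I_d)$ are drawn independently at every step; $\nu_k$ denotes the law of $X_k$. Let $\pi$ be the probability distribution with density $e^{-f(x)}/\int e^{-f(y)}\,dy$. For probability measures $\mu,\nu$ on $\mathbb{R}^d$ let $W_2(\mu,\nu)=\inf \mathbb{E}\|X-Y\|^2$, the infimum being over all joint distributions of $X\sim\mu$ and $Y\sim\nu$ (the square of the usual $2$-Wasserstein distance). Theorem. For every $c\in(0,1]$ there is a constant $\gamma>0$ depending only on $c$, and for every $B$ there is a constant $C>0$ depending only on $c$ and $B$, such that the following holds for all $d$, all $0<m\le M$ and all twice differentiable $f:\mathbb{R}^d\to\mathbb{R}$ with $mI\preceq\nabla^2 f(x)\preceq MI$ for all $x$. Let $c\,\frac{\sqrt m}{M}\le T\le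 \frac{\sqrt m}{M}$. Then: (i) two chains that use the same momentum contract: $\|x_T(x,\xi)-x_T(y,\xi)\|\le\left(1-\gamma\frac{m^2}{M^2}\right)\|x-y\|$ for all $x,y,\xi\in\mathbb{R}^d$; (ii) if $\nu_0$ and $\pi$ both have mean of norm at most $B$ and variance $\mathbb{E}\|X-\mathbb{E}X\|^2$ at most $B$, then for every $\varepsilon>0$ and every number of steps $k\ge C\left(\frac Mm\right)^2\max\left\{1,\log\frac1\varepsilon\right\}$ we have $W_2(\nu_k,\pi)\le\varepsilon$. -/

import Mathlib

open MeasureTheory ProbabilityTheory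

namespace HMC

noncomputable section

/-- The Hamiltonian vector field of `H(x, v) = f(x) + ‖v‖² / 2`: the phase-space point `(x, v)`
moves with velocity `(∂H/∂v, -∂H/∂x) = (v, -∇f(x))`. -/
def hamiltonianField {d : ℕ} (f : EuclideanSpace ℝ (Fin d) → ℝ)
    (p : EuclideanSpace ℝ (Fin d) × EuclideanSpace ℝ (Fin d)) :
    EuclideanSpace ℝ (Fin d) × EuclideanSpace ℝ (Fin d) :=
  (p.2, -gradient f p.1)

/-- `z : ℝ → ℝᵈ × ℝᵈ` solves Hamilton's equations for all `t ≥ 0`, starting from `p = (x, v)`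
(the derivative at `t = 0` is one-sided). -/
def IsHamiltonianTrajectory {d : ℕ} (f : EuclideanSpace ℝ (Fin d) → ℝ)
    (p : EuclideanSpace ℝ (Fin d) × EuclideanSpace ℝ (Fin d))
    (z : ℝ → EuclideanSpace ℝ (Fin d) × EuclideanSpace ℝ (Fin d)) : Prop :=
  z 0 = p ∧ IsIntegralCurveOn z (fun _ q => hamiltonianField f q) (Set.Ici 0)

open Classical in
/-- The Hamiltonian flow `φ_t`, `t ≥ 0`: position and velocity at time `t` of the solution of
Hamilton's equations that starts from `p = (x, v)`. (If there were no global solution, the value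
would be the starting point; if `∇f` is Lipschitz, then the solution exists and is unique.) -/
def hamiltonianFlow {d : ℕ} (f : EuclideanSpace ℝ (Fin d) → ℝ) (t : ℝ)
    (p : EuclideanSpace ℝ (Fin d) × EuclideanSpace ℝ (Fin d)) :
    EuclideanSpace ℝ (Fin d) × EuclideanSpace ℝ (Fin d) :=
  if h : ∃ z, IsHamiltonianTrajectory f p z then h.choose t else p

/-- One step of idealized HMC with integration time `T`, from position `x` with sampled momentum
`ξ`: the position component `x_T(x, ξ)` of `φ_T(x, ξ)`. -/
def hmcStep {d : ℕ} (f : EuclideanSpace ℝ (Fin d) → ℝ) (T : ℝ)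
    (x ξ : EuclideanSpace ℝ (Fin d)) : EuclideanSpace ℝ (Fin d) :=
  (hamiltonianFlow f T (x, ξ)).1

/-- The law `ν_k` of the `k`-th iterate `X_k` of idealized HMC started from `X_0 ∼ ν₀`:
`X_{k+1} = x_T(X_k, ξ)` with a fresh momentum `ξ ∼ N(0, I_d)`, independent of `X_k`. -/
def hmcLaw {d : ℕ} (f : EuclideanSpace ℝ (Fin d) → ℝ) (T : ℝ)
    (ν₀ : Measure (EuclideanSpace ℝ (Fin d))) : ℕ → Measure (EuclideanSpace ℝ (Fin d))
  | 0 => ν₀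
  | k + 1 => ((hmcLaw f T ν₀ k).prod (stdGaussian (EuclideanSpace ℝ (Fin d)))).map
      (fun p => hmcStep f T p.1 p.2)

/-- The Gibbs distribution: the measure with Lebesgue density `e^{-f(x)} / ∫ e^{-f(y)} dy`. -/
def gibbs {d : ℕ} (f : EuclideanSpace ℝ (Fin d) → ℝ) : Measure (EuclideanSpace ℝ (Fin d)) :=
  (volume : Measure (EuclideanSpace ℝ (Fin d))).tilted (fun x => -f x)

/-- The mean of `μ` has norm at most `B`, and the variance `E ‖X - E X‖²`, `X ∼ μ`, is at most `B`.
The variance is a Lebesgue integral with values in `[0, ∞]`; for a probability measure its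
finiteness forces a finite second moment, so that the mean is a genuine integral. -/
def MeanVarianceBound {d : ℕ} (μ : Measure (EuclideanSpace ℝ (Fin d))) (B : ℝ) : Prop :=
  ‖∫ x, x ∂μ‖ ≤ B ∧ ∫⁻ x, ‖x - ∫ y, y ∂μ‖ₑ ^ 2 ∂μ ≤ ENNReal.ofReal B

/-- `W₂` in the convention used here (no square root): the infimum over all joint distributions of
`X ∼ μ` and `Y ∼ ν` of `E ‖X - Y‖²`. -/
def W₂ {d : ℕ} (μ ν : Measure (EuclideanSpace ℝ (Fin d))) : ENNReal :=
  ⨅ (ρ : Measure (EuclideanSpace ℝ (Fin d) × EuclideanSpace ℝ (Fin d)))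
    (_ : ρ.map Prod.fst = μ ∧ ρ.map Prod.snd = ν), ∫⁻ p, ‖p.1 - p.2‖ₑ ^ 2 ∂ρ

end

end HMC

/-! Contraction. Let two trajectories share the initial momentum, with position difference `δ`,
velocity difference `η`, gradient difference `G`, and let `u = T - t` be the remaining time. The
functional `‖δ + uη‖² + u²‖η‖²` equals `‖x - y‖²` at time 0, where `η = 0`, and the squared final
distance at time `T`, where `u = 0`. The vector `δ + uη` predicts the final difference under free
motion, so its derivative is just `-uG`. The only term of indefinite sign in the dissipation, `⟨G,
η⟩`, is absorbed by co-coercivity `‖G‖² ≤ M⟨G, δ⟩` and `M T² ≤ 1`; strong convexity turns the rest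
into exponential decay (`dissipation_le`, `norm_hmcStep_sub_le`). Since `m T² ≥ c² m²/M²`, this
gives the claimed rate.

Stationarity. The flow conserves energy, so only volume preservation is missing. As `∇f` is merely
Lipschitz, there is no Jacobian to differentiate; instead the flow is a pointwise limit of iterated
symplectic Euler steps, which are compositions of volume preserving shears. Such a limit cannot
increase volume (`map_hamiltonianFlow_le`), and for a finite invariant density equality of total
mass upgrades the inequality to invariance (`map_hmcStep_gibbs`).

Convergence in `W₂`. Run one chain from `ν₀` and one from `gibbs f` with the same momenta: the
second remains stationary, and the expected squared distance shrinks by the squared contraction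
factor at each step (`exists_coupling_hmcLaw`). -/

/-! ### Lipschitz ODEs: global solutions and convergence of one-step methods. -/

section LipschitzODE

open Set Filter Topology NNReal

variable {E : Type*} [NormedAddCommGroup E] [NormedSpace ℝ E]

/-- A Lipschitz vector field has solutions on time intervals of a uniform length. -/
lemma exists_solution_Icc [CompleteSpace E] {F : E → E} {K : ℝ≥0} (hF : LipschitzWith K F) (p : E) :
    ∃ α : ℝ → E, α 0 = p ∧ ∀ t ∈ Icc (0 : ℝ) (1 / (1 + K)),
      HasDerivWithinAt α (F (α t)) (Icc (0 : ℝ) (1 / (1 + K))) t := by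
  have hτ : (0 : ℝ) ≤ 1 / (1 + K) := by positivity
  -- On the ball of radius `‖F p‖` around `p` the speed is at most `(1 + K) * ‖F p‖`, so a solution
  -- stays inside for time `1 / (1 + K)`. This time does not depend on `p`, which is what allows
  -- gluing.
  have h : IsPicardLindelof (fun _ => F) (tmin := 0) (tmax := 1 / (1 + K)) ⟨0, le_refl _, hτ⟩ p
      ‖F p‖₊ 0 ((1 + K) * ‖F p‖₊) K := by
    refine ⟨fun _ _ => hF.lipschitzOnWith, fun _ _ => continuousOn_const, fun _ _ x hx => ?_, ?_⟩
    · have h1 : ‖F x - F p‖ ≤ K * ‖F p‖ :=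
        (hF.norm_sub_le x p).trans (by gcongr; simpa [dist_eq_norm] using hx)
      have h2 : ‖F x‖ ≤ ‖F x - F p‖ + ‖F p‖ := by simpa using norm_add_le (F x - F p) (F p)
      push_cast
      linarith
    · have h1 : (0 : ℝ) < 1 + K := by positivity
      simp only [sub_zero, sub_self, max_eq_left hτ]
      push_cast
      apply le_of_eq
      field_simp
      simp
  exact h.exists_eq_forall_mem_Icc_hasDerivWithinAt₀

/-- A Lipschitz vector field on a Banach space has global forward solutions. -/
theorem exists_solution_Ici [CompleteSpace E] {F : E → E} {K : ℝ≥0} (hF : LipschitzWith K F)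
    (p : E) : ∃ z : ℝ → E, z 0 = p ∧ IsIntegralCurveOn z (fun _ => F) (Ici 0) := by
  choose α hα0 hα using exists_solution_Icc hF
  set τ : ℝ := 1 / (1 + K) with hτ
  have hτ0 : 0 < τ := by positivity
  let q : ℕ → E := fun n => (fun x => α x τ)^[n] p
  have hq : ∀ n, q (n + 1) = α (q n) τ := fun n => Function.iterate_succ_apply' _ _ _
  let z : ℝ → E := fun t => α (q ⌊t / τ⌋₊) (t - ⌊t / τ⌋₊ * τ)
  -- The right endpoint is included: there the floor jumps to `n + 1`, but the next piece starts at
  -- the point where this one ends.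
  have hz : ∀ n : ℕ, ∀ t ∈ Icc (n * τ) (n * τ + τ), z t = α (q n) (t - n * τ) := by
    intro n t ht
    rcases eq_or_lt_of_le ht.2 with h | h
    · have : ⌊t / τ⌋₊ = n + 1 := by
        have : t / τ = ((n + 1 : ℕ) : ℝ) := by rw [h]; push_cast; field_simp
        rw [this, Nat.floor_natCast]
      simp only [z, this, hq]
      rw [h]
      push_cast
      rw [show (n * τ + τ - (n + 1) * τ : ℝ) = 0 by ring, hα0, add_sub_cancel_left]
    · have : ⌊t / τ⌋₊ = n := by
        rw [Nat.floor_eq_iff (div_nonneg ((by positivity : 0 ≤ n * τ).trans ht.1) hτ0.le)]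
        exact ⟨(le_div_iff₀ hτ0).2 ht.1, (div_lt_iff₀ hτ0).2 (by linarith)⟩
      simp only [z, this]
  have hd : ∀ n : ℕ, ∀ t ∈ Icc (n * τ) (n * τ + τ),
      HasDerivWithinAt z (F (z t)) (Icc (n * τ) (n * τ + τ)) t := by
    intro n t ht
    have h1 : t - n * τ ∈ Icc (0 : ℝ) τ := ⟨by linarith [ht.1], by linarith [ht.2]⟩
    have hmaps : MapsTo (fun s => s - n * τ) (Icc (n * τ) (n * τ + τ)) (Icc (0 : ℝ) τ) :=
      fun s hs => ⟨by linarith [hs.1], by linarith [hs.2]⟩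
    have h2 := (hα (q n) (t - n * τ) h1).scomp t
      ((hasDerivWithinAt_id t (Icc (n * τ) (n * τ + τ))).sub_const (n * τ)) hmaps
    rw [one_smul] at h2
    rw [hz n t ht]
    exact h2.congr (fun s hs => hz n s hs) (hz n t ht)
  refine ⟨z, by simpa [hα0, q] using hz 0 0 (by simp [hτ0.le]), fun t ht => ?_⟩
  have ht0 : (0 : ℝ) ≤ t := ht
  set n := ⌊t / τ⌋₊ with hn
  have hn1 : n * τ ≤ t := by
    rw [← le_div_iff₀ hτ0]; exact Nat.floor_le (by positivity)
  have hn2 : t < n * τ + τ := by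
    have := Nat.lt_floor_add_one (t / τ)
    rw [div_lt_iff₀ hτ0] at this
    linarith
  have key := hd n t ⟨hn1, hn2.le⟩
  -- At a positive grid point the one-sided derivatives of the two adjacent pieces agree, both being
  -- `F (z t)`; at 0 only a right derivative is needed.
  rcases eq_or_lt_of_le hn1 with h | h
  · rcases Nat.eq_zero_or_pos n with h0 | h0
    · refine key.mono_of_mem_nhdsWithin ?_
      have ht' : t = 0 := by rw [← h, h0]; simp
      rw [h0, ht']
      simpa using Icc_mem_nhdsGE hτ0
    · obtain ⟨k, hk⟩ : ∃ k, n = k + 1 := ⟨n - 1, by omega⟩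
      have hkt : (k : ℝ) * τ + τ = t := by rw [← h, hk]; push_cast; ring
      have h3 := (hd k t ⟨by linarith, by linarith⟩).union key
      refine h3.mono_of_mem_nhdsWithin (mem_nhdsWithin_of_mem_nhds ?_)
      rw [hkt, h, Icc_union_Icc_eq_Icc (by linarith) (by linarith)]
      exact Icc_mem_nhds (by linarith) (by linarith)
  · exact (key.hasDerivAt (Icc_mem_nhds h hn2)).hasDerivWithinAt

lemma IsIntegralCurveOn.continuousOn_Icc {F : E → E} {z : ℝ → E} {T : ℝ}
    (hz : IsIntegralCurveOn z (fun _ => F) (Ici 0)) : ContinuousOn z (Icc 0 T) :=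
  fun t ht => ((hz t ht.1).mono Icc_subset_Ici_self).continuousWithinAt

lemma IsIntegralCurveOn.dist_le {F : E → E} {K : ℝ≥0} (hF : LipschitzWith K F) {z w : ℝ → E}
    (hz : IsIntegralCurveOn z (fun _ => F) (Ici 0)) (hw : IsIntegralCurveOn w (fun _ => F) (Ici 0))
    {t : ℝ} (ht : 0 ≤ t) : dist (z t) (w t) ≤ dist (z 0) (w 0) * Real.exp (K * t) := by
  simpa using dist_le_of_trajectories_ODE (v := fun _ => F) (a := 0) (b := t) (fun _ => hF)
    (IsIntegralCurveOn.continuousOn_Icc hz)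
    (fun s hs => (hz s hs.1).mono (Ici_subset_Ici.2 hs.1)) (IsIntegralCurveOn.continuousOn_Icc hw)
    (fun s hs => (hw s hs.1).mono (Ici_subset_Ici.2 hs.1)) le_rfl t ⟨ht, le_rfl⟩

/-- Along a solution of a Lipschitz ODE, the explicit Euler step has a quadratic local error. -/
lemma IsIntegralCurveOn.exists_euler_error {F : E → E} {K : ℝ≥0} (hF : LipschitzWith K F)
    {z : ℝ → E} (hz : IsIntegralCurveOn z (fun _ => F) (Ici 0)) (T : ℝ) :
    ∃ b : ℝ, 0 ≤ b ∧ ∀ t h : ℝ, 0 ≤ t → 0 ≤ h → t + h ≤ T →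
      ‖z (t + h) - z t - h • F (z t)‖ ≤ b * h ^ 2 := by
  obtain ⟨V, hV⟩ := isCompact_Icc.exists_bound_of_continuousOn
    (hF.continuous.comp_continuousOn (IsIntegralCurveOn.continuousOn_Icc (T := T) hz))
  have hV' : ∀ t ∈ Icc 0 T, ‖F (z t)‖ ≤ max V 0 := fun t ht => (hV t ht).trans (le_max_left _ _)
  refine ⟨K * max V 0, by positivity, fun t h ht hh hT => ?_⟩
  have hsub : Icc t (t + h) ⊆ Ici 0 := fun s hs => ht.trans hs.1
  have h1 : ∀ s ∈ Icc t (t + h), ‖z s - z t‖ ≤ max V 0 * h := by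
    intro s hs
    have := (convex_Icc t (t + h)).norm_image_sub_le_of_norm_hasDerivWithin_le
      (fun r hr => (hz r (hsub hr)).mono hsub)
      (fun r hr => hV' r ⟨hsub hr, hr.2.trans hT⟩) (left_mem_Icc.2 (by linarith)) hs
    refine this.trans ?_
    rw [Real.norm_of_nonneg (by linarith [hs.1])]
    gcongr
    linarith [hs.2]
  have h2 := (convex_Icc t (t + h)).norm_image_sub_le_of_norm_hasDerivWithin_le
    (f := fun s => z s - s • F (z t)) (f' := fun s => F (z s) - (1 : ℝ) • F (z t))
    (C := K * (max V 0 * h))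
    (fun r hr => ((hz r (hsub hr)).mono hsub).sub ((hasDerivWithinAt_id r _).smul_const (F (z t))))
    (fun r hr => by
      rw [one_smul]
      exact (hF.norm_sub_le _ _).trans (by gcongr; exact h1 r hr))
    (left_mem_Icc.2 (by linarith)) (right_mem_Icc.2 (by linarith))
  calc ‖z (t + h) - z t - h • F (z t)‖
      = ‖z (t + h) - (t + h) • F (z t) - (z t - t • F (z t))‖ := by congr 1; module
    _ ≤ K * (max V 0 * h) * ‖t + h - t‖ := h2
    _ = K * max V 0 * h ^ 2 := by
      rw [add_sub_cancel_left, Real.norm_of_nonneg hh]; ring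

/-- A consistent one-step method for a Lipschitz ODE converges. -/
theorem tendsto_oneStep_iterate {F : E → E} {K : ℝ≥0} (hF : LipschitzWith K F)
    {S : ℝ → E → E} {A : ℝ} (hA : 0 ≤ A)
    (hS : ∀ h p, 0 ≤ h → ‖S h p - p - h • F p‖ ≤ A * h ^ 2 * ‖p‖)
    {z : ℝ → E} (hz : IsIntegralCurveOn z (fun _ => F) (Ici 0)) {T : ℝ} (hT : 0 ≤ T) :
    Tendsto (fun n : ℕ => (S (T / (n + 1)))^[n + 1] (z 0)) atTop (𝓝 (z T)) := by
  obtain ⟨b, hb, hloc⟩ := IsIntegralCurveOn.exists_euler_error hF hz T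
  obtain ⟨R, hR⟩ := isCompact_Icc.exists_bound_of_continuousOn
    (IsIntegralCurveOn.continuousOn_Icc (T := T) hz)
  have hR0 : 0 ≤ R := (norm_nonneg _).trans (hR 0 ⟨le_rfl, hT⟩)
  have bound : ∀ n : ℕ, ‖(S (T / (n + 1)))^[n + 1] (z 0) - z T‖ ≤
      ((A * R + b) * T ^ 2 * Real.exp (K * T + A * T ^ 2)) * (1 / ((n : ℝ) + 1)) := by
    intro n
    set h : ℝ := T / (n + 1) with hh
    have hn : (0 : ℝ) < n + 1 := by positivity
    have hh0 : 0 ≤ h := by positivity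
    have hhT : (n + 1) * h = T := by rw [hh]; field_simp
    -- One-step growth factor of the error. The term `A * h ^ 2` arises from bounding the iterate by
    -- `R` plus the current error, so no a priori bound on the iterates is needed.
    set ρ : ℝ := 1 + K * h + A * h ^ 2 with hρ
    have hρ1 : 1 ≤ ρ := by
      have : 0 ≤ K * h + A * h ^ 2 := by positivity
      linarith
    have hrec : ∀ k : ℕ, k ≤ n + 1 →
        ‖(S h)^[k] (z 0) - z (k * h)‖ ≤ k * ((A * R + b) * h ^ 2) * ρ ^ k := by
      intro k
      induction k with
      | zero => intro _; simp
      | succ k ih =>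
        intro hk
        have ih := ih (by omega)
        have hkT : k * h + h ≤ T := by
          have : ((k + 1 : ℕ) : ℝ) ≤ n + 1 := by exact_mod_cast hk
          push_cast at this
          rw [← hhT]
          nlinarith
        rw [Function.iterate_succ_apply']
        set p := (S h)^[k] (z 0)
        have e1 := hS h p hh0
        have e2 := hloc (k * h) h (by positivity) hh0 hkT
        have e3 := hR (k * h) ⟨by positivity, by linarith⟩
        have e4 : ‖p‖ ≤ R + ‖p - z (k * h)‖ := by
          have := norm_add_le (z (k * h)) (p - z (k * h))
          rw [add_sub_cancel] at this
          linarith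
        have e5 := hF.norm_sub_le p (z (k * h))
        have e6 : S h p - z ((k + 1 : ℕ) * h) = (S h p - p - h • F p) + (p - z (k * h)) +
            h • (F p - F (z (k * h))) - (z (k * h + h) - z (k * h) - h • F (z (k * h))) := by
          push_cast
          rw [add_mul, one_mul]
          module
        have e7 : ‖S h p - z ((k + 1 : ℕ) * h)‖ ≤
            ρ * ‖p - z (k * h)‖ + (A * R + b) * h ^ 2 := by
          rw [e6]
          refine (norm_sub_le _ _).trans ?_
          have t1 := norm_add₃_le (a := S h p - p - h • F p) (b := p - z (k * h))
            (c := h • (F p - F (z (k * h))))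
          rw [norm_smul, Real.norm_of_nonneg hh0] at t1
          have t2 := mul_le_mul_of_nonneg_left e5 hh0
          have t3 := mul_le_mul_of_nonneg_left e4 (by positivity : 0 ≤ A * h ^ 2)
          rw [hρ]
          linarith
        have hβ : 0 ≤ (A * R + b) * h ^ 2 := by positivity
        have hpow : 1 ≤ ρ ^ (k + 1) := one_le_pow₀ hρ1
        calc _ ≤ ρ * ‖p - z (k * h)‖ + (A * R + b) * h ^ 2 := e7
          _ ≤ ρ * (k * ((A * R + b) * h ^ 2) * ρ ^ k) + (A * R + b) * h ^ 2 * ρ ^ (k + 1) := by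
            exact add_le_add (mul_le_mul_of_nonneg_left ih (by linarith))
              (le_mul_of_one_le_right hβ hpow)
          _ = _ := by push_cast; ring
    have hfin := hrec (n + 1) le_rfl
    push_cast at hfin
    rw [hhT] at hfin
    refine hfin.trans ?_
    have hρe : ρ ^ (n + 1) ≤ Real.exp (K * T + A * T ^ 2) := by
      have h1 : ρ ≤ Real.exp (K * h + A * h ^ 2) := by
        have := Real.add_one_le_exp (K * h + A * h ^ 2)
        rw [hρ]; linarith
      have hhT' : h ≤ T := by
        rw [← hhT]; nlinarith [(by positivity : (0 : ℝ) ≤ n)]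
      calc ρ ^ (n + 1) ≤ Real.exp (K * h + A * h ^ 2) ^ (n + 1) :=
            pow_le_pow_left₀ (by linarith) h1 _
        _ = Real.exp (K * ((n + 1) * h) + A * (((n + 1) * h) * h)) := by
            rw [← Real.exp_nat_mul]; congr 1; push_cast; ring
        _ ≤ _ := by
            rw [hhT, pow_two]
            gcongr
    have h2 : ((n : ℝ) + 1) * ((A * R + b) * h ^ 2) = (A * R + b) * T ^ 2 * (1 / ((n : ℝ) + 1)) := by
      rw [hh]; field_simp
    rw [h2, mul_right_comm]
    gcongr
  refine tendsto_iff_norm_sub_tendsto_zero.2 (squeeze_zero (fun _ => norm_nonneg _) bound ?_)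
  simpa using (tendsto_one_div_add_atTop_nhds_zero_nat (𝕜 := ℝ)).const_mul
    ((A * R + b) * T ^ 2 * Real.exp (K * T + A * T ^ 2))

end LipschitzODE

/-! ### Convexity inequalities from pointwise Hessian bounds. -/

section HessianBounds

open Set

variable {E : Type*} [NormedAddCommGroup E] [InnerProductSpace ℝ E] [CompleteSpace E] {f : E → ℝ}

/-- The Hessian of a twice differentiable function is symmetric. -/
lemma inner_fderiv_gradient_comm (hf : Differentiable ℝ f)
    (hg : Differentiable ℝ (gradient f)) (x u w : E) :
    inner ℝ (fderiv ℝ (gradient f) x u) w = inner ℝ (fderiv ℝ (gradient f) x w) u := by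
  have h1 : ∀ y, HasFDerivAt f (innerSL ℝ (gradient f y)) y := fun y =>
    (hf y).hasGradientAt.hasFDerivAt
  have h2 : HasFDerivAt (fun y => innerSL ℝ (gradient f y))
      ((innerSL ℝ).comp (fderiv ℝ (gradient f) x)) x :=
    (innerSL ℝ).hasFDerivAt.comp x (hg x).hasFDerivAt
  exact second_derivative_symmetric h1 h2 u w

lemma hasDerivAt_inner_gradient_line (hg : Differentiable ℝ (gradient f)) (x u w : E) (t : ℝ) :
    HasDerivAt (fun s : ℝ => inner ℝ (gradient f (x + s • u)) w)
      (inner ℝ (fderiv ℝ (gradient f) (x + t • u) u) w) t := by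
  have h1 : HasDerivAt (fun s : ℝ => x + s • u) u t := by
    simpa using ((hasDerivAt_id t).smul_const u).const_add x
  have h2 := (hg (x + t • u)).hasFDerivAt.comp_hasDerivAt t h1
  simpa using h2.inner ℝ (hasDerivAt_const t w)

/-- Mean value theorem for a linear functional of the gradient along a segment. -/
lemma exists_inner_gradient_sub_eq (hg : Differentiable ℝ (gradient f)) (x y : E) (a b : ℝ)
    (w : E) : ∃ z, a * inner ℝ (gradient f x - gradient f y) w
      + b * inner ℝ (gradient f x - gradient f y) (x - y) =
      a * inner ℝ (fderiv ℝ (gradient f) z (x - y)) w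
      + b * inner ℝ (fderiv ℝ (gradient f) z (x - y)) (x - y) := by
  have hd := fun t => ((hasDerivAt_inner_gradient_line hg y (x - y) w t).const_mul a).add
    ((hasDerivAt_inner_gradient_line hg y (x - y) (x - y) t).const_mul b)
  obtain ⟨t, -, ht⟩ := exists_hasDerivAt_eq_slope _ _ zero_lt_one
    (fun t _ => (hd t).continuousAt.continuousWithinAt) (fun t _ => hd t)
  refine ⟨y + t • (x - y), ?_⟩
  rw [ht]
  simp only [Pi.add_apply, one_smul, zero_smul, add_zero, add_sub_cancel, inner_sub_left]
  ring

variable {m M : ℝ}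

lemma mul_norm_sub_sq_le_inner_gradient_sub (hg : Differentiable ℝ (gradient f))
    (hm : ∀ x u : E, m * ‖u‖ ^ 2 ≤ inner ℝ (fderiv ℝ (gradient f) x u) u) (x y : E) :
    m * ‖x - y‖ ^ 2 ≤ inner ℝ (gradient f x - gradient f y) (x - y) := by
  obtain ⟨z, hz⟩ := exists_inner_gradient_sub_eq hg x y 0 1 0
  simp only [zero_mul, one_mul, zero_add] at hz
  rw [hz]
  exact hm z _

/-- Co-coercivity of the gradient. -/
lemma norm_gradient_sub_sq_le (hf : Differentiable ℝ f) (hg : Differentiable ℝ (gradient f))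
    (hM : 0 < M)
    (h0 : ∀ x u : E, 0 ≤ inner ℝ (fderiv ℝ (gradient f) x u) u)
    (h1 : ∀ x u : E, inner ℝ (fderiv ℝ (gradient f) x u) u ≤ M * ‖u‖ ^ 2) (x y : E) :
    ‖gradient f x - gradient f y‖ ^ 2 ≤ M * inner ℝ (gradient f x - gradient f y) (x - y) := by
  -- The Hessian need not be continuous, so it is not integrated along the segment; one mean value
  -- point serves both pairings. The weights `2` and `-M` are those for which positivity of the
  -- Hessian `H` at `M • (x - y) - G`, together with `⟨HG, G⟩ ≤ M‖G‖²`, bounds the right side by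
  -- `‖G‖²`.
  obtain ⟨z, hz⟩ := exists_inner_gradient_sub_eq hg x y 2 (-M) (gradient f x - gradient f y)
  set G := gradient f x - gradient f y
  set H := fderiv ℝ (gradient f) z
  have hpos := h0 z (M • (x - y) - G)
  have hsymm := inner_fderiv_gradient_comm hf hg z G (x - y)
  have hG := h1 z G
  change inner ℝ (H G) _ = inner ℝ (H _) _ at hsymm
  change 0 ≤ inner ℝ (H _) _ at hpos
  change inner ℝ (H G) G ≤ _ at hG
  simp only [map_sub H (M • (x - y)), map_smul H, inner_sub_left, inner_sub_right (𝕜 := ℝ) _ (M • (x - y)),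
    inner_smul_left, inner_smul_right, RCLike.conj_to_real] at hpos
  rw [hsymm] at hpos
  rw [real_inner_self_eq_norm_sq] at hz
  have h2 : 0 ≤ M * (M * inner ℝ (H (x - y)) (x - y) - 2 * inner ℝ (H (x - y)) G + ‖G‖ ^ 2) := by
    linarith
  have h3 := nonneg_of_mul_nonneg_right h2 hM
  linarith

lemma lipschitzWith_gradient (hf : Differentiable ℝ f) (hg : Differentiable ℝ (gradient f))
    (hM : 0 < M)
    (h0 : ∀ x u : E, 0 ≤ inner ℝ (fderiv ℝ (gradient f) x u) u)
    (h1 : ∀ x u : E, inner ℝ (fderiv ℝ (gradient f) x u) u ≤ M * ‖u‖ ^ 2) :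
    LipschitzWith M.toNNReal (gradient f) := by
  refine LipschitzWith.of_dist_le_mul fun x y => ?_
  rw [dist_eq_norm, dist_eq_norm, Real.coe_toNNReal _ hM.le]
  have h2 := norm_gradient_sub_sq_le hf hg hM h0 h1 x y
  have h3 := real_inner_le_norm (gradient f x - gradient f y) (x - y)
  rcases eq_or_lt_of_le (norm_nonneg (gradient f x - gradient f y)) with h | h
  · rw [← h]; positivity
  · have h4 := mul_le_mul_of_nonneg_left h3 hM.le
    refine le_of_mul_le_mul_left ?_ h
    nlinarith

/-- Along the ray from 0 to `x` the difference of the two sides has nonnegative derivative by strong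
monotonicity of the gradient. The bound makes `exp (-f)` integrable by Gaussian domination. -/
lemma quadratic_lower_bound (hf : Differentiable ℝ f) (hg : Differentiable ℝ (gradient f))
    (hm : ∀ x u : E, m * ‖u‖ ^ 2 ≤ inner ℝ (fderiv ℝ (gradient f) x u) u) (x : E) :
    f 0 + inner ℝ (gradient f 0) x + m / 2 * ‖x‖ ^ 2 ≤ f x := by
  have hd : ∀ t : ℝ, HasDerivAt
      (fun t : ℝ => f (t • x) - t * inner ℝ (gradient f 0) x - t ^ 2 * (m / 2 * ‖x‖ ^ 2))
      (inner ℝ (gradient f (t • x)) x - 1 * inner ℝ (gradient f 0) x -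
        ((2 : ℕ) * t ^ (2 - 1) * 1) * (m / 2 * ‖x‖ ^ 2)) t := by
    intro t
    have h1 : HasDerivAt (fun s : ℝ => s • x) x t := by
      simpa using (hasDerivAt_id t).smul_const x
    have h2 := (hf (t • x)).hasGradientAt.hasFDerivAt.comp_hasDerivAt t h1
    exact (h2.sub ((hasDerivAt_id t).mul_const _)).sub (((hasDerivAt_id t).pow 2).mul_const _)
  have hmono := monotoneOn_of_deriv_nonneg (convex_Icc (0 : ℝ) 1)
    (fun t _ => (hd t).continuousAt.continuousWithinAt)
    (fun t _ => (hd t).differentiableAt.differentiableWithinAt) (fun t ht => by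
      rw [interior_Icc] at ht
      rw [(hd t).deriv]
      have h := mul_norm_sub_sq_le_inner_gradient_sub hg hm (t • x) 0
      rw [sub_zero, inner_smul_right, norm_smul, Real.norm_of_nonneg ht.1.le, inner_sub_left] at h
      have h2 : t * (m * t * ‖x‖ ^ 2) ≤ t * (inner ℝ (gradient f (t • x)) x
        - inner ℝ (gradient f 0) x) := by linarith
      have h3 := le_of_mul_le_mul_left h2 ht.1
      push_cast
      linarith)
  have := hmono (left_mem_Icc.2 zero_le_one) (right_mem_Icc.2 zero_le_one) zero_le_one
  simp at this ⊢
  linarith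

end HessianBounds

/-! ### Invariant measures under pointwise limits of maps. -/

section PointwiseLimit

open Set Filter Topology ENNReal

/-- A pointwise limit of measure preserving maps does not increase the measure of sets. -/
theorem MeasureTheory.MeasurePreserving.map_le_of_tendsto {X : Type*} [TopologicalSpace X]
    [MeasurableSpace X] [BorelSpace X] {μ : Measure X} [μ.OuterRegular] {φ : ℕ → X → X} {ψ : X → X}
    (hφ : ∀ n, MeasurePreserving (φ n) μ μ) (hψ : Measurable ψ)
    (hlim : ∀ x, Tendsto (fun n => φ n x) atTop (𝓝 (ψ x))) : μ.map ψ ≤ μ := by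
  -- If `ψ x` lies in an open set, so does `φ n x` for all large `n`; Fatou's lemma then compares
  -- the measures. Outer regularity extends this to measurable sets.
  have hopen : ∀ U, IsOpen U → μ (ψ ⁻¹' U) ≤ μ U := by
    intro U hU
    calc μ (ψ ⁻¹' U) = ∫⁻ x, (ψ ⁻¹' U).indicator 1 x ∂μ :=
          (lintegral_indicator_one (hψ hU.measurableSet)).symm
      _ ≤ ∫⁻ x, liminf (fun n => (φ n ⁻¹' U).indicator (1 : X → ℝ≥0∞) x) atTop ∂μ := by
          refine lintegral_mono fun x => ?_
          by_cases hx : x ∈ ψ ⁻¹' U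
          · rw [indicator_of_mem hx]
            refine le_liminf_of_le (by isBoundedDefault) ?_
            filter_upwards [(hlim x).eventually (hU.mem_nhds hx)] with n hn
            rw [indicator_of_mem (show x ∈ φ n ⁻¹' U from hn)]
          · rw [indicator_of_notMem hx]
            exact zero_le
      _ ≤ liminf (fun n => ∫⁻ x, (φ n ⁻¹' U).indicator (1 : X → ℝ≥0∞) x ∂μ) atTop :=
          lintegral_liminf_le fun n =>
            measurable_one.indicator ((hφ n).measurable hU.measurableSet)
      _ = μ U := by
          simp_rw [fun n => lintegral_indicator_one (μ := μ)
            ((hφ n).measurable hU.measurableSet),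
            fun n => (hφ n).measure_preimage hU.measurableSet.nullMeasurableSet]
          exact liminf_const _
  refine Measure.le_iff.2 fun A hA => ?_
  rw [Measure.map_apply hψ hA]
  refine le_of_forall_gt fun r hr => ?_
  obtain ⟨U, hAU, hU, hUr⟩ := A.exists_isOpen_lt_of_lt r hr
  exact ((measure_mono (preimage_mono hAU)).trans (hopen U hU)).trans_lt hUr

/-- If `ψ` does not increase the measure of sets and preserves the density of a finite measure,
then it preserves this finite measure. -/
theorem MeasureTheory.measurePreserving_withDensity_of_map_le {X : Type*} [MeasurableSpace X]
    {μ : Measure X} {ψ : X → X} (hψ : Measurable ψ) (hle : μ.map ψ ≤ μ) {ρ : X → ℝ≥0∞}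
    (hρ : Measurable ρ) (hinv : ∀ x, ρ (ψ x) = ρ x) [IsFiniteMeasure (μ.withDensity ρ)] :
    MeasurePreserving ψ (μ.withDensity ρ) (μ.withDensity ρ) := by
  refine ⟨hψ, ?_⟩
  have h : (μ.withDensity ρ).map ψ = (μ.map ψ).withDensity ρ := by
    ext A hA
    rw [Measure.map_apply hψ hA, withDensity_apply _ (hψ hA), withDensity_apply _ hA,
      setLIntegral_map hA hρ hψ]
    simp_rw [hinv]
  have hle' : (μ.withDensity ρ).map ψ ≤ μ.withDensity ρ := by
    rw [h]
    refine Measure.le_iff.2 fun A hA => ?_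
    rw [withDensity_apply _ hA, withDensity_apply _ hA]
    exact lintegral_mono' (Measure.restrict_mono le_rfl hle) le_rfl
  refine Measure.eq_of_le_of_measure_univ_eq hle' ?_
  rw [Measure.map_apply hψ .univ, preimage_univ]

end PointwiseLimit

/-! ### Gaussian integrals and the density of the standard Gaussian. -/

section Gaussian

variable {E : Type*} [NormedAddCommGroup E] [InnerProductSpace ℝ E] [FiniteDimensional ℝ E]
  [MeasurableSpace E] [BorelSpace E]

lemma integrable_exp_neg_mul_sq_norm_add_inner {b : ℝ} (hb : 0 < b) (w : E) :
    Integrable (fun v : E => Real.exp (-b * ‖v‖ ^ 2 + inner ℝ w v)) := by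
  have h := (GaussianFourier.integrable_cexp_neg_mul_sq_norm_add (V := E) (b := b)
    (by simpa using hb) 1 w).re
  refine h.congr (ae_of_all _ fun v => ?_)
  have : (-(b : ℂ) * (‖v‖ : ℂ) ^ 2 + 1 * ((inner ℝ w v : ℝ) : ℂ)) =
      ((-b * ‖v‖ ^ 2 + inner ℝ w v : ℝ) : ℂ) := by push_cast; ring
  simp only [this, ← Complex.ofReal_exp]
  exact Complex.ofReal_re _

/-- The standard Gaussian measure has Lebesgue density proportional to `exp (-‖x‖² / 2)`. -/
lemma stdGaussian_eq_tilted :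
    stdGaussian E = (volume : Measure E).tilted (fun x => -(‖x‖ ^ 2 / 2)) := by
  have hint : Integrable (fun v : E => Real.exp (-(‖v‖ ^ 2 / 2))) := by
    refine (integrable_exp_neg_mul_sq_norm_add_inner (E := E) (b := 1 / 2) (by norm_num) 0).congr
      (ae_of_all _ fun v => ?_)
    simp only [inner_zero_left]
    congr 1
    ring
  have := isProbabilityMeasure_tilted hint
  refine Measure.ext_of_charFun ?_
  funext t
  rw [charFun_stdGaussian, charFun_apply, integral_tilted]
  have e1 : ∀ x : E, (Real.exp (-(‖x‖ ^ 2 / 2)) / ∫ v : E, Real.exp (-(‖v‖ ^ 2 / 2))) •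
      Complex.exp ((inner ℝ x t : ℝ) * Complex.I) =
      ((∫ v : E, Real.exp (-(‖v‖ ^ 2 / 2)) : ℝ) : ℂ)⁻¹ *
        Complex.exp (-(1 / 2 : ℂ) * (‖x‖ : ℂ) ^ 2 + Complex.I * (inner ℝ t x : ℝ)) := by
    intro x
    rw [Complex.exp_add, real_inner_comm]
    simp only [Complex.real_smul]
    push_cast
    ring_nf
  have e2 : ((∫ v : E, Real.exp (-(‖v‖ ^ 2 / 2)) : ℝ) : ℂ) =
      (Real.pi / (1 / 2 : ℂ)) ^ (Module.finrank ℝ E / 2 : ℂ) := by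
    rw [← GaussianFourier.integral_cexp_neg_mul_sq_norm (V := E) (b := 1 / 2) (by norm_num),
      ← integral_complex_ofReal]
    congr 1
    funext v
    push_cast
    ring_nf
  simp_rw [e1]
  rw [integral_const_mul, GaussianFourier.integral_cexp_neg_mul_sq_norm_add (by norm_num), e2,
    inv_mul_cancel_left₀]
  · simp
    ring_nf
  · rw [← e2]
    exact_mod_cast (integral_exp_pos hint).ne'

end Gaussian

/-! ### The Hamiltonian flow: existence, continuity and energy conservation. -/

namespace HMC

open Set Filter Topology NNReal ENNReal

variable {d : ℕ} {f : EuclideanSpace ℝ (Fin d) → ℝ}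

local notation "𝔼" => EuclideanSpace ℝ (Fin d)

lemma lipschitzWith_hamiltonianField {L : ℝ≥0} (hL : LipschitzWith L (gradient f)) :
    LipschitzWith (max 1 L) (hamiltonianField f) := by
  have h := (LipschitzWith.prod_snd (α := 𝔼) (β := 𝔼)).prodMk
    (hL.comp (LipschitzWith.prod_fst (α := 𝔼) (β := 𝔼))).neg
  rw [mul_one] at h
  exact h

lemma isHamiltonianTrajectory_hamiltonianFlow {L : ℝ≥0} (hL : LipschitzWith L (gradient f))
    (p : 𝔼 × 𝔼) : IsHamiltonianTrajectory f p (fun t => hamiltonianFlow f t p) := by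
  have h : ∃ z, IsHamiltonianTrajectory f p z :=
    exists_solution_Ici (lipschitzWith_hamiltonianField hL) p
  have h2 : (fun t => hamiltonianFlow f t p) = h.choose := by
    funext t
    rw [hamiltonianFlow, dif_pos h]
  rw [h2]
  exact h.choose_spec

lemma continuous_hamiltonianFlow {L : ℝ≥0} (hL : LipschitzWith L (gradient f)) {t : ℝ}
    (ht : 0 ≤ t) : Continuous (hamiltonianFlow f t) := by
  refine (LipschitzWith.of_dist_le_mul (K := (Real.exp ((max 1 L : ℝ≥0) * t)).toNNReal)
    fun p q => ?_).continuous
  have hp := isHamiltonianTrajectory_hamiltonianFlow hL p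
  have hq := isHamiltonianTrajectory_hamiltonianFlow hL q
  have h := hp.2.dist_le (lipschitzWith_hamiltonianField hL) hq.2 ht
  have hp0 : hamiltonianFlow f 0 p = p := hp.1
  have hq0 : hamiltonianFlow f 0 q = q := hq.1
  rw [hp0, hq0, mul_comm] at h
  rwa [Real.coe_toNNReal _ (Real.exp_pos _).le]

/-- Along the Hamiltonian flow, the velocity is the derivative of the position, and `-∇f` is the
derivative of the velocity. -/
lemma IsHamiltonianTrajectory.hasDerivWithinAt {p : 𝔼 × 𝔼} {z : ℝ → 𝔼 × 𝔼}
    (hz : IsHamiltonianTrajectory f p z) {t : ℝ} (ht : 0 ≤ t) :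
    HasDerivWithinAt (fun s => (z s).1) (z t).2 (Ici 0) t ∧
    HasDerivWithinAt (fun s => (z s).2) (-gradient f (z t).1) (Ici 0) t := by
  have h := hz.2 t ht
  exact ⟨(ContinuousLinearMap.fst ℝ 𝔼 𝔼).hasFDerivAt.comp_hasDerivWithinAt t h,
    (ContinuousLinearMap.snd ℝ 𝔼 𝔼).hasFDerivAt.comp_hasDerivWithinAt t h⟩

/-- Conservation of energy. -/
lemma hamiltonian_hamiltonianFlow (hf : Differentiable ℝ f) {L : ℝ≥0}
    (hL : LipschitzWith L (gradient f)) {t : ℝ} (ht : 0 ≤ t) (p : 𝔼 × 𝔼) :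
    f (hamiltonianFlow f t p).1 + ‖(hamiltonianFlow f t p).2‖ ^ 2 / 2 =
      f p.1 + ‖p.2‖ ^ 2 / 2 := by
  have hz := isHamiltonianTrajectory_hamiltonianFlow hL p
  set z := fun t => hamiltonianFlow f t p with hzdef
  have hd : ∀ s ∈ Icc 0 t, HasDerivWithinAt (fun s => f (z s).1 + ‖(z s).2‖ ^ 2 / 2) 0
      (Icc 0 t) s := by
    intro s hs
    obtain ⟨h1, h2⟩ := hz.hasDerivWithinAt hs.1
    have h3 := (hf (z s).1).hasGradientAt.hasFDerivAt.comp_hasDerivWithinAt s h1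
    refine ((h3.add (h2.norm_sq.div_const 2)).congr_deriv ?_).mono Icc_subset_Ici_self
    simp only [InnerProductSpace.toDual_apply_apply, inner_neg_right]
    rw [real_inner_comm]
    ring
  have h := (convex_Icc 0 t).norm_image_sub_le_of_norm_hasDerivWithin_le (C := 0) hd
    (fun _ _ => by simp) (left_mem_Icc.2 ht) (right_mem_Icc.2 ht)
  rw [zero_mul, norm_le_zero_iff, sub_eq_zero] at h
  have h0 : z 0 = p := hz.1
  rw [h0] at h
  exact h

/-! ### Contraction under synchronous coupling. -/

lemma exp_neg_le_one_sub_half {x : ℝ} (h0 : 0 ≤ x) (h1 : x ≤ 1) :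
    Real.exp (-x) ≤ 1 - x / 2 := by
  have h := Real.quadratic_le_exp_of_nonneg h0
  rw [Real.exp_neg, inv_le_comm₀ (Real.exp_pos _) (by linarith)]
  refine le_trans ?_ h
  rw [inv_le_iff_one_le_mul₀ (by linarith)]
  nlinarith [mul_nonneg h0 h0, mul_nonneg h0 (mul_nonneg h0 (sub_nonneg.2 h1))]

/-- Pointwise dissipation estimate behind the contraction of synchronously coupled chains. -/
lemma dissipation_le {E : Type*} [NormedAddCommGroup E] [InnerProductSpace ℝ E] {m M T u : ℝ}
    (hm : 0 < m) (hmM : m ≤ M) (hT : 0 < T) (hMT : M * T ^ 2 ≤ 1) (hu : 0 ≤ u) (huT : u ≤ T)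
    {δ η G : E} (h1 : m * ‖δ‖ ^ 2 ≤ inner ℝ G δ) (h2 : ‖G‖ ^ 2 ≤ M * inner ℝ G δ) :
    -2 * u * inner ℝ G δ - 4 * u ^ 2 * inner ℝ G η - 2 * u * ‖η‖ ^ 2 ≤
      -(2 / 3 * m * (u - u ^ 2 / T)) * (‖δ + u • η‖ ^ 2 + u ^ 2 * ‖η‖ ^ 2) := by
  set a : ℝ := inner ℝ G δ
  have ha : 0 ≤ a := le_trans (by positivity) h1
  set r := u / T with hr
  have hr0 : 0 ≤ r := by positivity
  have hr1 : r ≤ 1 := (div_le_one hT).2 huT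
  have hrT : r * T = u := by rw [hr]; field_simp
  have hG : u * ‖G‖ ≤ r * Real.sqrt a := by
    refine le_of_sq_le_sq ?_ (by positivity)
    rw [mul_pow, mul_pow, Real.sq_sqrt ha]
    calc u ^ 2 * ‖G‖ ^ 2 ≤ u ^ 2 * (M * a) := by gcongr
      _ = r ^ 2 * (M * T ^ 2) * a := by rw [← hrT]; ring
      _ ≤ r ^ 2 * 1 * a := by gcongr
      _ = r ^ 2 * a := by ring
  have hcross : -(2 * u * inner ℝ G η) ≤ r * (a + ‖η‖ ^ 2) := by
    have e1 : -inner ℝ G η ≤ ‖G‖ * ‖η‖ := (neg_le_abs _).trans (abs_real_inner_le_norm G η)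
    have e2 := mul_le_mul_of_nonneg_left e1 (mul_nonneg zero_le_two hu)
    have e3 := mul_le_mul_of_nonneg_right hG (norm_nonneg η)
    have e4 := mul_nonneg hr0 (sq_nonneg (Real.sqrt a - ‖η‖))
    have e5 := Real.sq_sqrt ha
    nlinarith
  have hcross' := mul_le_mul_of_nonneg_left hcross (mul_nonneg zero_le_two hu)
  have hmu : m * u ^ 2 ≤ 1 :=
    le_trans (mul_le_mul hmM (pow_le_pow_left₀ hu huT 2) (by positivity) (hm.le.trans hmM)) hMT
  -- With `m * u ^ 2 ≤ 1` this bounds `m` times the functional by `2a + 3‖η‖²`, the source of the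
  -- `3` below and of the `2 / 3` in the rate.
  have hsq : ‖δ + u • η‖ ^ 2 ≤ 2 * ‖δ‖ ^ 2 + 2 * (u ^ 2 * ‖η‖ ^ 2) := by
    have h := parallelogram_law_with_norm ℝ δ (u • η)
    have h' : ‖u • η‖ ^ 2 = u ^ 2 * ‖η‖ ^ 2 := by
      rw [norm_smul, mul_pow, Real.norm_eq_abs, sq_abs]
    nlinarith [sq_nonneg ‖δ - u • η‖]
  have hΨ : m * (‖δ + u • η‖ ^ 2 + u ^ 2 * ‖η‖ ^ 2) ≤ 3 * (a + ‖η‖ ^ 2) := by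
    have e1 := mul_le_mul_of_nonneg_right hmu (sq_nonneg ‖η‖)
    have e2 := mul_le_mul_of_nonneg_left hsq hm.le
    linarith
  have hfac : 0 ≤ 2 / 3 * (u * (1 - r)) := by
    have := mul_nonneg hu (sub_nonneg.2 hr1)
    linarith
  have hfin := mul_le_mul_of_nonneg_left hΨ hfac
  have e6 : u - u ^ 2 / T = u * (1 - r) := by rw [hr]; ring
  rw [e6]
  linarith

/-- A Grönwall argument for a functional that weights the velocity difference by the remaining time.
Its decay rate vanishes at both ends of `[0, T]` and integrates to `m * T ^ 2 / 9`; the square root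
and `exp (-x) ≤ 1 - x / 2` give the constant `36`. -/
theorem norm_hmcStep_sub_le {m M : ℝ} (hm : 0 < m) (hmM : m ≤ M)
    (hf : Differentiable ℝ f) (hg : Differentiable ℝ (gradient f))
    (hess : ∀ x u : 𝔼, m * ‖u‖ ^ 2 ≤ inner ℝ (fderiv ℝ (gradient f) x u) u ∧
      inner ℝ (fderiv ℝ (gradient f) x u) u ≤ M * ‖u‖ ^ 2)
    {T : ℝ} (hT : 0 < T) (hMT : M * T ^ 2 ≤ 1) (x y ξ : 𝔼) :
    ‖hmcStep f T x ξ - hmcStep f T y ξ‖ ≤ (1 - m * T ^ 2 / 36) * ‖x - y‖ := by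
  have hM := hm.trans_le hmM
  have h0 : ∀ x u : 𝔼, 0 ≤ inner ℝ (fderiv ℝ (gradient f) x u) u :=
    fun x u => le_trans (by positivity) (hess x u).1
  have hL := lipschitzWith_gradient hf hg hM h0 (fun x u => (hess x u).2)
  have hz := isHamiltonianTrajectory_hamiltonianFlow hL (x, ξ)
  have hw := isHamiltonianTrajectory_hamiltonianFlow hL (y, ξ)
  simp only [hmcStep]
  set z := fun t => hamiltonianFlow f t (x, ξ) with hzdef
  set w := fun t => hamiltonianFlow f t (y, ξ) with hwdef
  change ‖(z T).1 - (w T).1‖ ≤ _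
  let δ : ℝ → 𝔼 := fun t => (z t).1 - (w t).1
  let η : ℝ → 𝔼 := fun t => (z t).2 - (w t).2
  let G : ℝ → 𝔼 := fun t => gradient f (z t).1 - gradient f (w t).1
  have hδ : ∀ t, 0 ≤ t → HasDerivWithinAt δ (η t) (Ici 0) t := fun t ht =>
    (hz.hasDerivWithinAt ht).1.sub (hw.hasDerivWithinAt ht).1
  have hη : ∀ t, 0 ≤ t → HasDerivWithinAt η (-G t) (Ici 0) t := fun t ht =>
    ((hz.hasDerivWithinAt ht).2.sub (hw.hasDerivWithinAt ht).2).congr_deriv (by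
      simp only [G]; abel)
  let Ψ : ℝ → ℝ := fun t => ‖δ t + (T - t) • η t‖ ^ 2 + (T - t) ^ 2 * ‖η t‖ ^ 2
  -- The antiderivative of the decay rate in `dissipation_le` at `u = T - t`, normalised to vanish
  -- at `T`; `exp (g t)` is the integrating factor.
  let g : ℝ → ℝ := fun t => -(2 / 3 * m) * ((T - t) ^ 2 / 2 - (T - t) ^ 3 / (3 * T))
  have hu : ∀ t : ℝ, HasDerivAt (fun t : ℝ => T - t) (-1) t := fun t => by
    simpa using (hasDerivAt_id t).const_sub T
  have hΨ : ∀ t, 0 ≤ t → HasDerivWithinAt Ψ (-2 * (T - t) * inner ℝ (G t) (δ t)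
      - 4 * (T - t) ^ 2 * inner ℝ (G t) (η t) - 2 * (T - t) * ‖η t‖ ^ 2) (Ici 0) t := by
    intro t ht
    have h1 := ((hδ t ht).add ((hu t).hasDerivWithinAt.smul (hη t ht))).norm_sq
    have h2 := ((hu t).hasDerivWithinAt.pow 2).mul (hη t ht).norm_sq
    refine (h1.add h2).congr_deriv ?_
    simp only [Pi.add_apply, Pi.smul_apply', Pi.pow_apply, inner_add_left, inner_add_right, inner_smul_left,
      inner_smul_right, inner_neg_right, RCLike.conj_to_real, real_inner_self_eq_norm_sq,
      real_inner_comm (δ t) (G t), real_inner_comm (η t) (G t)]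
    push_cast
    ring
  have hgd : ∀ t, HasDerivAt g (2 / 3 * m * ((T - t) - (T - t) ^ 2 / T)) t := by
    intro t
    refine ((((hu t).pow 2).div_const 2).sub
      (((hu t).pow 3).div_const (3 * T))).const_mul (-(2 / 3 * m)) |>.congr_deriv ?_
    field_simp
    push_cast
    ring
  have hanti : AntitoneOn (fun t => Ψ t * Real.exp (g t)) (Icc 0 T) := by
    have hd : ∀ t ∈ Ici (0 : ℝ), HasDerivWithinAt (fun t => Ψ t * Real.exp (g t)) _ (Ici 0) t :=
      fun t ht => (hΨ t ht).mul (hgd t).exp.hasDerivWithinAt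
    refine antitoneOn_of_hasDerivWithinAt_nonpos (convex_Icc 0 T)
      (fun t ht => ((hd t ht.1).mono Icc_subset_Ici_self).continuousWithinAt)
      (fun t ht => (hd t ?_).mono ?_) (fun t ht => ?_)
    · rw [interior_Icc] at ht; exact ht.1.le
    · rw [interior_Icc]; exact fun s hs => hs.1.le
    · rw [interior_Icc] at ht
      have h1 := mul_norm_sub_sq_le_inner_gradient_sub hg (fun x u => (hess x u).1)
        (z t).1 (w t).1
      have h2 := norm_gradient_sub_sq_le hf hg hM h0 (fun x u => (hess x u).2) (z t).1 (w t).1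
      have h3 := dissipation_le (η := η t) hm hmM hT hMT (sub_nonneg.2 ht.2.le)
        (by linarith [ht.1]) h1 h2
      have h4 := mul_le_mul_of_nonneg_right h3 (Real.exp_pos (g t)).le
      simp only [Ψ]
      simp only [δ, G] at h4 ⊢
      linarith
  have hfin := hanti (left_mem_Icc.2 hT.le) (right_mem_Icc.2 hT.le) hT.le
  have hη0 : η 0 = 0 := by
    have h1 : z 0 = (x, ξ) := hz.1
    have h2 : w 0 = (y, ξ) := hw.1
    simp [η, h1, h2]
  have hδ0 : δ 0 = x - y := by
    have h1 : z 0 = (x, ξ) := hz.1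
    have h2 : w 0 = (y, ξ) := hw.1
    simp [δ, h1, h2]
  have hg0 : g 0 = -(m * T ^ 2 / 9) := by
    simp only [g]
    field_simp
    ring
  have hgT : g T = 0 := by simp [g]
  have hΨT : Ψ T = ‖δ T‖ ^ 2 := by simp [Ψ]
  have hΨ0 : Ψ 0 = ‖x - y‖ ^ 2 := by simp [Ψ, hη0, hδ0]
  simp only [hg0, hgT, hΨT, hΨ0, Real.exp_zero, mul_one] at hfin
  have hmT : m * T ^ 2 ≤ 1 := le_trans (by gcongr) hMT
  have hmT0 : 0 ≤ m * T ^ 2 := by positivity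
  have h5 : Real.exp (-(m * T ^ 2 / 9)) ≤ (1 - m * T ^ 2 / 36) ^ 2 := by
    have := exp_neg_le_one_sub_half (x := m * T ^ 2 / 18) (by linarith) (by linarith)
    calc Real.exp (-(m * T ^ 2 / 9)) = Real.exp (-(m * T ^ 2 / 18)) ^ 2 := by
          rw [← Real.exp_nat_mul]; congr 1; push_cast; ring
      _ ≤ _ := pow_le_pow_left₀ (Real.exp_pos _).le (by linarith) 2
  refine le_of_sq_le_sq ?_ (mul_nonneg (by linarith) (norm_nonneg _))
  rw [mul_pow, mul_comm]
  exact hfin.trans (mul_le_mul_of_nonneg_left h5 (by positivity))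

/-! ### Volume preservation and stationarity of the Gibbs distribution. -/

/-- One step of the symplectic Euler method with step size `h`. -/
noncomputable def symplecticEuler (f : EuclideanSpace ℝ (Fin d) → ℝ) (h : ℝ) (p : 𝔼 × 𝔼) : 𝔼 × 𝔼 :=
  (p.1 + h • p.2, p.2 - h • gradient f (p.1 + h • p.2))

/-- Drift and kick each translate one coordinate by a function of the other, so Fubini and
translation invariance suffice; no derivative of the gradient enters. -/
lemma measurePreserving_symplecticEuler (hg : Continuous (gradient f)) (h : ℝ) :
    MeasurePreserving (symplecticEuler f h) := by
  have drift : MeasurePreserving (fun p : 𝔼 × 𝔼 => (p.1, p.2 + h • p.1)) :=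
    (MeasurePreserving.id (volume : Measure 𝔼)).skew_product (g := fun v x => x + h • v)
      (by fun_prop) (ae_of_all _ fun v => map_add_right_eq_self volume (h • v))
  have kick : MeasurePreserving (fun p : 𝔼 × 𝔼 => (p.1, p.2 - h • gradient f p.1)) :=
    (MeasurePreserving.id (volume : Measure 𝔼)).skew_product
      (g := fun x v => v - h • gradient f x)
      (by
        have := hg.measurable
        fun_prop) (ae_of_all _ fun x => (measurePreserving_sub_right volume _).map_eq)
  have hswap : MeasurePreserving (Prod.swap : 𝔼 × 𝔼 → 𝔼 × 𝔼) := Measure.measurePreserving_swap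
  exact kick.comp (hswap.comp (drift.comp hswap))

/-- The position update is exactly the Euler one. The velocity updates differ only in where the
gradient is evaluated, at points `h • p.2` apart, so the error is quadratic in `h` and linear in
`‖p‖`. -/
lemma norm_symplecticEuler_sub_le {L : ℝ≥0} (hL : LipschitzWith L (gradient f)) (h : ℝ)
    (p : 𝔼 × 𝔼) (hh : 0 ≤ h) :
    ‖symplecticEuler f h p - p - h • hamiltonianField f p‖ ≤ L * h ^ 2 * ‖p‖ := by
  have e : symplecticEuler f h p - p - h • hamiltonianField f p =
      (0, h • (gradient f p.1 - gradient f (p.1 + h • p.2))) := by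
    ext1
    · simp [symplecticEuler, hamiltonianField]
    · simp only [symplecticEuler, hamiltonianField, Prod.snd_sub, Prod.smul_snd]
      module
  rw [e, Prod.norm_mk, norm_zero, max_eq_right (norm_nonneg _), norm_smul,
    Real.norm_of_nonneg hh]
  have h1 := hL.norm_sub_le p.1 (p.1 + h • p.2)
  rw [sub_add_cancel_left, norm_neg, norm_smul, Real.norm_of_nonneg hh] at h1
  calc h * ‖gradient f p.1 - gradient f (p.1 + h • p.2)‖ ≤ h * (L * (h * ‖p.2‖)) := by gcongr
    _ = L * h ^ 2 * ‖p.2‖ := by ring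
    _ ≤ _ := by gcongr; exact norm_snd_le p

/-- Liouville's theorem (in the form of an inequality) for a merely Lipschitz force. -/
theorem map_hamiltonianFlow_le {L : ℝ≥0} (hL : LipschitzWith L (gradient f)) {t : ℝ}
    (ht : 0 ≤ t) : (volume : Measure (𝔼 × 𝔼)).map (hamiltonianFlow f t) ≤ volume := by
  have : (volume : Measure (𝔼 × 𝔼)).IsAddHaarMeasure :=
    inferInstanceAs (((volume : Measure 𝔼).prod (volume : Measure 𝔼)).IsAddHaarMeasure)
  refine MeasurePreserving.map_le_of_tendsto
    (φ := fun n => (symplecticEuler f (t / (n + 1)))^[n + 1])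
    (fun n => (measurePreserving_symplecticEuler hL.continuous _).iterate _)
    (continuous_hamiltonianFlow hL ht).measurable fun p => ?_
  have hz := isHamiltonianTrajectory_hamiltonianFlow hL p
  have h := tendsto_oneStep_iterate (lipschitzWith_hamiltonianField hL) L.2
    (fun h p hh => norm_symplecticEuler_sub_le hL h p hh) hz.2 ht
  have h0 : hamiltonianFlow f 0 p = p := hz.1
  rwa [h0] at h

lemma integrable_exp_neg {m : ℝ} (hm : 0 < m) (hf : Differentiable ℝ f)
    (hg : Differentiable ℝ (gradient f))
    (hess : ∀ x u : 𝔼, m * ‖u‖ ^ 2 ≤ inner ℝ (fderiv ℝ (gradient f) x u) u) :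
    Integrable (fun x => Real.exp (-f x)) := by
  refine ((integrable_exp_neg_mul_sq_norm_add_inner (half_pos hm)
    (-gradient f 0)).const_mul (Real.exp (-f 0))).mono'
    (hf.continuous.neg.rexp.aestronglyMeasurable) (ae_of_all _ fun x => ?_)
  rw [Real.norm_of_nonneg (Real.exp_pos _).le, ← Real.exp_add, Real.exp_le_exp, inner_neg_left]
  linarith [quadratic_lower_bound hf hg hess x]

/-- The Gibbs distribution is stationary for idealized HMC. -/
theorem map_hmcStep_gibbs (hf : Differentiable ℝ f) {L : ℝ≥0}
    (hL : LipschitzWith L (gradient f)) (hint : Integrable (fun x => Real.exp (-f x))) {T : ℝ}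
    (hT : 0 ≤ T) :
    ((gibbs f).prod (stdGaussian 𝔼)).map (fun p => hmcStep f T p.1 p.2) = gibbs f := by
  have : IsProbabilityMeasure (gibbs f) := isProbabilityMeasure_tilted hint
  have hprod : ∃ ρ : 𝔼 × 𝔼 → ENNReal, Measurable ρ ∧
      (∀ p, ρ (hamiltonianFlow f T p) = ρ p) ∧
      (gibbs f).prod (stdGaussian 𝔼) = (volume : Measure (𝔼 × 𝔼)).withDensity ρ := by
    refine ⟨fun z => ENNReal.ofReal (Real.exp (-f z.1) / ∫ x, Real.exp (-f x)) *
      ENNReal.ofReal (Real.exp (-(‖z.2‖ ^ 2 / 2)) / ∫ v : 𝔼, Real.exp (-(‖v‖ ^ 2 / 2))),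
      ?_, ?_, ?_⟩
    · have := hf.continuous.measurable
      fun_prop
    -- The joint density depends on position and velocity only through the energy, which the flow
    -- conserves.
    · intro p
      have hE := hamiltonian_hamiltonianFlow hf hL hT p
      simp only
      rw [← ENNReal.ofReal_mul (by positivity), ← ENNReal.ofReal_mul (by positivity),
        div_mul_div_comm, div_mul_div_comm, ← Real.exp_add, ← Real.exp_add]
      congr 3
      linarith
    · rw [stdGaussian_eq_tilted, gibbs, Measure.tilted, Measure.tilted, prod_withDensity]
      · rfl
      · have := hf.continuous.measurable
        fun_prop
      · fun_prop
  obtain ⟨ρ, hρ, hinv, heq⟩ := hprod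
  have hfin : IsFiniteMeasure ((volume : Measure (𝔼 × 𝔼)).withDensity ρ) := by
    rw [← heq]; infer_instance
  have hcont := (continuous_hamiltonianFlow hL hT).measurable
  have hmp := measurePreserving_withDensity_of_map_le hcont (map_hamiltonianFlow_le hL hT) hρ hinv
  rw [← heq] at hmp
  have h1 := Measure.map_map (μ := (gibbs f).prod (stdGaussian 𝔼)) measurable_fst hcont
  rw [hmp.map_eq, Measure.map_fst_prod, measure_univ, one_smul] at h1
  exact h1.symm

lemma hmcLaw_gibbs {T : ℝ}
    (hinv : ((gibbs f).prod (stdGaussian 𝔼)).map (fun p => hmcStep f T p.1 p.2) = gibbs f)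
    (k : ℕ) : hmcLaw f T (gibbs f) k = gibbs f := by
  induction k with
  | zero => rfl
  | succ k ih => rw [hmcLaw, ih, hinv]

/-! ### Propagation of couplings and the number of steps. -/

/-- Couplings propagate along two HMC chains that use the same momenta, and their transport cost
contracts. -/
theorem exists_coupling_hmcLaw {T q : ℝ}
    (hmeas : Measurable fun p : 𝔼 × 𝔼 => hmcStep f T p.1 p.2)
    (hcontr : ∀ x y ξ : 𝔼, ‖hmcStep f T x ξ - hmcStep f T y ξ‖ ≤ q * ‖x - y‖)
    (ρ₀ : Measure (𝔼 × 𝔼)) [IsProbabilityMeasure ρ₀] (k : ℕ) :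
    ∃ ρ : Measure (𝔼 × 𝔼), IsProbabilityMeasure ρ ∧
      ρ.map Prod.fst = hmcLaw f T (ρ₀.map Prod.fst) k ∧
      ρ.map Prod.snd = hmcLaw f T (ρ₀.map Prod.snd) k ∧
      ∫⁻ p, ‖p.1 - p.2‖ₑ ^ 2 ∂ρ ≤
        ENNReal.ofReal ((q ^ 2) ^ k) * ∫⁻ p, ‖p.1 - p.2‖ₑ ^ 2 ∂ρ₀ := by
  induction k with
  | zero => exact ⟨ρ₀, ‹_›, rfl, rfl, by simp⟩
  | succ k ih =>
    obtain ⟨ρ, hρ, h1, h2, hcost⟩ := ih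
    have hm1 : Measurable fun r : (𝔼 × 𝔼) × 𝔼 => hmcStep f T r.1.1 r.2 :=
      hmeas.comp ((measurable_fst.comp measurable_fst).prodMk measurable_snd)
    have hm2 : Measurable fun r : (𝔼 × 𝔼) × 𝔼 => hmcStep f T r.1.2 r.2 :=
      hmeas.comp ((measurable_snd.comp measurable_fst).prodMk measurable_snd)
    have hm := hm1.prodMk hm2
    refine ⟨(ρ.prod (stdGaussian 𝔼)).map
      (fun r => (hmcStep f T r.1.1 r.2, hmcStep f T r.1.2 r.2)),
      Measure.isProbabilityMeasure_map hm.aemeasurable, ?_, ?_, ?_⟩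
    · have h := Measure.map_prod_map ρ (stdGaussian 𝔼) measurable_fst measurable_id
      rw [Measure.map_id] at h
      rw [Measure.map_map measurable_fst hm, hmcLaw, ← h1, h,
        Measure.map_map hmeas (measurable_fst.prodMap measurable_id)]
      rfl
    · have h := Measure.map_prod_map ρ (stdGaussian 𝔼) measurable_snd measurable_id
      rw [Measure.map_id] at h
      rw [Measure.map_map measurable_snd hm, hmcLaw, ← h2, h,
        Measure.map_map hmeas (measurable_snd.prodMap measurable_id)]
      rfl
    · have hcm : Measurable fun p : 𝔼 × 𝔼 => ‖p.1 - p.2‖ₑ ^ 2 := by fun_prop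
      rw [lintegral_map hcm hm]
      calc ∫⁻ r, ‖hmcStep f T r.1.1 r.2 - hmcStep f T r.1.2 r.2‖ₑ ^ 2 ∂(ρ.prod (stdGaussian 𝔼))
          ≤ ∫⁻ r, ENNReal.ofReal (q ^ 2) * ‖r.1.1 - r.1.2‖ₑ ^ 2 ∂(ρ.prod (stdGaussian 𝔼)) := by
            refine lintegral_mono fun r => ?_
            simp only [← ofReal_norm]
            rw [← ENNReal.ofReal_pow (norm_nonneg _), ← ENNReal.ofReal_pow (norm_nonneg _),
              ← ENNReal.ofReal_mul (by positivity), ← mul_pow]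
            exact ENNReal.ofReal_le_ofReal
              (pow_le_pow_left₀ (norm_nonneg _) (hcontr r.1.1 r.1.2 r.2) 2)
        _ = ENNReal.ofReal (q ^ 2) * ∫⁻ p, ‖p.1 - p.2‖ₑ ^ 2 ∂ρ := by
            rw [lintegral_const_mul _ (by fun_prop)]
            congr 1
            rw [← lintegral_map hcm measurable_fst, Measure.map_fst_prod, measure_univ, one_smul]
        _ ≤ ENNReal.ofReal (q ^ 2) *
            (ENNReal.ofReal ((q ^ 2) ^ k) * ∫⁻ p, ‖p.1 - p.2‖ₑ ^ 2 ∂ρ₀) := by gcongr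
        _ = _ := by
            rw [← mul_assoc, ← ENNReal.ofReal_mul (by positivity), pow_succ' (q ^ 2)]

lemma enorm_sub_sq_le (x y a b : 𝔼) : ‖x - y‖ₑ ^ 2 ≤
    4 * (‖x - a‖ₑ ^ 2 + ‖y - b‖ₑ ^ 2 + ENNReal.ofReal (‖a‖ ^ 2 + ‖b‖ ^ 2)) := by
  simp only [← ofReal_norm]
  rw [← ENNReal.ofReal_pow (norm_nonneg _), ← ENNReal.ofReal_pow (norm_nonneg _),
    ← ENNReal.ofReal_pow (norm_nonneg _), ← ENNReal.ofReal_add (by positivity) (by positivity),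
    ← ENNReal.ofReal_add (by positivity) (by positivity),
    show (4 : ℝ≥0∞) = ENNReal.ofReal 4 by simp, ← ENNReal.ofReal_mul (by norm_num)]
  refine ENNReal.ofReal_le_ofReal ?_
  have h : ‖x - y‖ ≤ ‖x - a‖ + ‖y - b‖ + ‖a‖ + ‖b‖ := by
    have e : x - y = (x - a) - (y - b) + (a - b) := by abel
    rw [e]
    linarith [norm_add_le ((x - a) - (y - b)) (a - b), norm_sub_le (x - a) (y - b),
      norm_sub_le a b]
  refine (pow_le_pow_left₀ (norm_nonneg _) h 2).trans ?_
  nlinarith [sq_nonneg (‖x - a‖ - ‖y - b‖), sq_nonneg (‖x - a‖ - ‖a‖), sq_nonneg (‖x - a‖ - ‖b‖),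
    sq_nonneg (‖y - b‖ - ‖a‖), sq_nonneg (‖y - b‖ - ‖b‖), sq_nonneg (‖a‖ - ‖b‖)]

/-- The independent coupling of two measures with bounded mean and variance has bounded cost. -/
lemma lintegral_prod_enorm_sub_sq_le {μ ν : Measure 𝔼} [IsProbabilityMeasure μ]
    [IsProbabilityMeasure ν] {B : ℝ} (hμ : MeanVarianceBound μ B) (hν : MeanVarianceBound ν B) :
    ∫⁻ p, ‖p.1 - p.2‖ₑ ^ 2 ∂(μ.prod ν) ≤ ENNReal.ofReal (8 * (B + B ^ 2)) := by
  set a := ∫ x, x ∂μ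
  set b := ∫ x, x ∂ν
  have hB : 0 ≤ B := (norm_nonneg _).trans hμ.1
  have hm1 : Measurable fun x : 𝔼 => ‖x - a‖ₑ ^ 2 := by fun_prop
  have hm2 : Measurable fun x : 𝔼 => ‖x - b‖ₑ ^ 2 := by fun_prop
  have h1 : ∫⁻ p : 𝔼 × 𝔼, ‖p.1 - a‖ₑ ^ 2 ∂(μ.prod ν) = ∫⁻ x, ‖x - a‖ₑ ^ 2 ∂μ := by
    rw [← lintegral_map hm1 measurable_fst, Measure.map_fst_prod, measure_univ, one_smul]
  have h2 : ∫⁻ p : 𝔼 × 𝔼, ‖p.2 - b‖ₑ ^ 2 ∂(μ.prod ν) = ∫⁻ x, ‖x - b‖ₑ ^ 2 ∂ν := by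
    rw [← lintegral_map hm2 measurable_snd, Measure.map_snd_prod, measure_univ, one_smul]
  calc ∫⁻ p, ‖p.1 - p.2‖ₑ ^ 2 ∂(μ.prod ν)
      ≤ ∫⁻ p, 4 * (‖p.1 - a‖ₑ ^ 2 + ‖p.2 - b‖ₑ ^ 2 + ENNReal.ofReal (‖a‖ ^ 2 + ‖b‖ ^ 2))
        ∂(μ.prod ν) := lintegral_mono fun p => enorm_sub_sq_le _ _ _ _
    _ = 4 * (∫⁻ x, ‖x - a‖ₑ ^ 2 ∂μ + ∫⁻ x, ‖x - b‖ₑ ^ 2 ∂ν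
        + ENNReal.ofReal (‖a‖ ^ 2 + ‖b‖ ^ 2)) := by
      rw [lintegral_const_mul _ (by fun_prop), lintegral_add_right _ measurable_const,
        lintegral_add_left (by fun_prop), h1, h2]
      simp
    _ ≤ 4 * (ENNReal.ofReal B + ENNReal.ofReal B + ENNReal.ofReal (B ^ 2 + B ^ 2)) := by
      gcongr
      exacts [hμ.2, hν.2, hμ.1, hν.1]
    _ = _ := by
      rw [← ENNReal.ofReal_add hB hB, ← ENNReal.ofReal_add (by positivity) (by positivity),
        show (4 : ℝ≥0∞) = ENNReal.ofReal 4 by simp, ← ENNReal.ofReal_mul (by norm_num)]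
      congr 1
      ring

/-- The number of steps after which geometric decay with rate `1 - s` brings `A` below `ε`. -/
lemma pow_mul_le_of_log_le {s A ε : ℝ} (hs0 : 0 < s) (hs1 : s ≤ 1) (hA : 1 ≤ A) (hε : 0 < ε)
    {k : ℕ} (hk : (Real.log A + 1) / s * max 1 (Real.log (1 / ε)) ≤ k) :
    ((1 - s) ^ 2) ^ k * A ≤ ε := by
  have hA0 : 0 < A := by linarith
  have hlogA := Real.log_nonneg hA
  have h1 : Real.log A + Real.log (1 / ε) ≤ k * s := by
    rw [div_mul_eq_mul_div, div_le_iff₀ hs0] at hk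
    refine le_trans ?_ hk
    have := mul_le_mul_of_nonneg_left (le_max_left 1 (Real.log (1 / ε))) hlogA
    linarith [le_max_right 1 (Real.log (1 / ε))]
  -- One factor `1 - s ≤ 1` is given away; this costs only a constant in the step count.
  have h2 : (1 - s) ^ 2 ≤ Real.exp (-s) := by
    have := Real.one_sub_le_exp_neg s
    nlinarith
  calc ((1 - s) ^ 2) ^ k * A ≤ Real.exp (-s) ^ k * Real.exp (Real.log A) := by
        rw [Real.exp_log hA0]
        gcongr
    _ = Real.exp (Real.log A - k * s) := by
        rw [← Real.exp_nat_mul, ← Real.exp_add]; congr 1; ring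
    _ ≤ Real.exp (Real.log ε) := by
        rw [one_div, Real.log_inv] at h1
        gcongr
        linarith
    _ = ε := Real.exp_log hε

end HMC

theorem theorem2 (c : ℝ) (hc₀ : 0 < c) (hc₁ : c ≤ 1) :
    ∃ γ : ℝ, 0 < γ ∧ ∀ B : ℝ, ∃ C : ℝ, 0 < C ∧
      ∀ (d : ℕ) (f : EuclideanSpace ℝ (Fin d) → ℝ) (m M : ℝ),
        0 < m → m ≤ M →
        Differentiable ℝ f → Differentiable ℝ (gradient f) →
        (∀ x u : EuclideanSpace ℝ (Fin d),
          m * ‖u‖ ^ 2 ≤ inner ℝ (fderiv ℝ (gradient f) x u) u ∧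
          inner ℝ (fderiv ℝ (gradient f) x u) u ≤ M * ‖u‖ ^ 2) →
        ∀ T : ℝ, c * (Real.sqrt m / M) ≤ T → T ≤ Real.sqrt m / M →
          (∀ x y ξ : EuclideanSpace ℝ (Fin d),
            ‖HMC.hmcStep f T x ξ - HMC.hmcStep f T y ξ‖ ≤
              (1 - γ * (m ^ 2 / M ^ 2)) * ‖x - y‖) ∧
          ∀ (ν₀ : MeasureTheory.Measure (EuclideanSpace ℝ (Fin d))),
            MeasureTheory.IsProbabilityMeasure ν₀ →
            HMC.MeanVarianceBound ν₀ B → HMC.MeanVarianceBound (HMC.gibbs f) B →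
            ∀ (ε : ℝ), 0 < ε → ∀ k : ℕ,
              C * (M / m) ^ 2 * max 1 (Real.log (1 / ε)) ≤ (k : ℝ) →
              HMC.W₂ (HMC.hmcLaw f T ν₀ k) (HMC.gibbs f) ≤ ENNReal.ofReal ε := by
  refine ⟨c ^ 2 / 36, by positivity, fun B => ?_⟩
  -- A bound for the cost of the initial independent coupling. The absolute value and the `+ 1` keep
  -- `log A` nonnegative for every real `B`, as `C` is chosen before the moment bounds force `B ≥
  -- 0`.
  set A : ℝ := 8 * (|B| + B ^ 2) + 1 with hA
  have hA1 : 1 ≤ A := by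
    have : 0 ≤ 8 * (|B| + B ^ 2) := by positivity
    linarith
  have hlogA := Real.log_nonneg hA1
  refine ⟨(Real.log A + 1) / (c ^ 2 / 36), by positivity,
    fun d f m M hm hmM hf hg hess T hT₁ hT₂ => ?_⟩
  have hM : 0 < M := hm.trans_le hmM
  have hsm := Real.sqrt_pos.2 hm
  have hT : 0 < T := lt_of_lt_of_le (by positivity) hT₁
  -- The upper bound on `T` enters only here, the lower bound in `hmT` and for `T > 0`.
  have hMT : M * T ^ 2 ≤ 1 := by
    calc M * T ^ 2 ≤ M * (Real.sqrt m / M) ^ 2 := by gcongr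
      _ = m / M := by rw [div_pow, Real.sq_sqrt hm.le]; field_simp
      _ ≤ 1 := (div_le_one hM).2 hmM
  have hmT : c ^ 2 * (m ^ 2 / M ^ 2) ≤ m * T ^ 2 := by
    calc c ^ 2 * (m ^ 2 / M ^ 2) = m * (c * (Real.sqrt m / M)) ^ 2 := by
          rw [mul_pow, div_pow, Real.sq_sqrt hm.le]; ring
      _ ≤ _ := by gcongr
  have hcontr : ∀ x y ξ : EuclideanSpace ℝ (Fin d),
      ‖HMC.hmcStep f T x ξ - HMC.hmcStep f T y ξ‖ ≤
        (1 - c ^ 2 / 36 * (m ^ 2 / M ^ 2)) * ‖x - y‖ := fun x y ξ =>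
    (HMC.norm_hmcStep_sub_le hm hmM hf hg hess hT hMT x y ξ).trans
      (mul_le_mul_of_nonneg_right (by linarith) (norm_nonneg _))
  refine ⟨hcontr, fun ν₀ hν₀ hB₁ hB₂ ε hε k hk => ?_⟩
  set s : ℝ := c ^ 2 / 36 * (m ^ 2 / M ^ 2) with hs
  have hs0 : 0 < s := by positivity
  have hs1 : s ≤ 1 := by
    have h1 : m * T ^ 2 ≤ M * T ^ 2 := by gcongr
    rw [hs]
    linarith
  have h0 : ∀ x u : EuclideanSpace ℝ (Fin d), 0 ≤ inner ℝ (fderiv ℝ (gradient f) x u) u :=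
    fun x u => le_trans (by positivity) (hess x u).1
  have hL := lipschitzWith_gradient hf hg hM h0 (fun x u => (hess x u).2)
  have hint := HMC.integrable_exp_neg hm hf hg (fun x u => (hess x u).1)
  have hmeas : Measurable fun p : EuclideanSpace ℝ (Fin d) × EuclideanSpace ℝ (Fin d) =>
      HMC.hmcStep f T p.1 p.2 :=
    measurable_fst.comp (HMC.continuous_hamiltonianFlow hL hT.le).measurable
  have hπ : IsProbabilityMeasure (HMC.gibbs f) := isProbabilityMeasure_tilted hint
  obtain ⟨ρ, -, h1, h2, hcost⟩ := HMC.exists_coupling_hmcLaw hmeas hcontr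
    (ν₀.prod (HMC.gibbs f)) k
  rw [Measure.map_fst_prod, measure_univ, one_smul] at h1
  rw [Measure.map_snd_prod, measure_univ, one_smul,
    HMC.hmcLaw_gibbs (HMC.map_hmcStep_gibbs hf hL hint hT.le)] at h2
  refine (iInf₂_le ρ ⟨h1, h2⟩).trans (hcost.trans ?_)
  have hAB : 8 * (B + B ^ 2) ≤ A := by
    rw [hA]; linarith [le_abs_self B]
  calc _ ≤ ENNReal.ofReal (((1 - s) ^ 2) ^ k) * ENNReal.ofReal A := by
        gcongr
        exact (HMC.lintegral_prod_enorm_sub_sq_le hB₁ hB₂).trans (ENNReal.ofReal_le_ofReal hAB)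
    _ = ENNReal.ofReal (((1 - s) ^ 2) ^ k * A) := (ENNReal.ofReal_mul (by positivity)).symm
    _ ≤ _ := by
        refine ENNReal.ofReal_le_ofReal (HMC.pow_mul_le_of_log_le hs0 hs1 hA1 hε ?_)
        refine le_trans (le_of_eq ?_) hk
        rw [hs]
        field_simp
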